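/- On the complex Hilbert space $L^2(\mathbb{R},\mathbb{C})$ let $\mathbf{a} = \tfrac{1}{\sqrt 2}\,(x+\partial_x)$ be the annihilation operator, with domain $\{f\in L^2 : xf\in L^2,\ f'\in L^2\}$ (weak derivative). Let $\alpha\in\mathbb{R}\setminus\{0\}$, let $k\ge 3$ be an integer, and let $\mathbf{L} = \mathbf{a}^k-\alpha^k\mathbf{1}$ with domain $\mathcal{D}(\mathbf{a}^k)$; write $\mathbf{L}^\dagger$ for its adjoint. Products and commutators of unbounded operators are taken on their natural domains, and $[A,B]^{(s)}$ denotes the $s$-th iterated right commutator: $[A,B]^{(1)}=[A,B]=AB-BA$ and $[A,B]^{(s+1)}=[[A,B]^{(s)},B]$. Define $$\mathcal{E}^a_{\mathbf{L}} = \operatorname{Span}\{(\mathbf{L}^\dagger)^j v \mid j\in\mathbb{N},\ v\in\ker\mathbf{L}\},$$ $$\mathcal{E}^\sharp_{\mathbf{L}} = \operatorname{Span}\{(\mathbf{L}^\dagger)^j[\mathbf{L},\mathbf{L}^\dagger]^{(s)} v \mid j\in\mathbb{N},\ 1\le s\le k-1,\ v\in\ker\mathbf{L}\},$$ where $\mathbb{N}=\{0,1,2,\dots\}$.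 Then every $v\in\ker\mathbf{L}$ lies in the domain of each operator $(\mathbf{L}^\dagger)^j$ and $(\mathbf{L}^\dagger)^j[\mathbf{L},\mathbf{L}^\dagger]^{(s)}$ that appears in these definitions, and $\mathcal{E}^a_{\mathbf{L}}+\mathcal{E}^\sharp_{\mathbf{L}}$ is dense in $L^2(\mathbb{R},\mathbb{C})$. -/

import Mathlib

open MeasureTheory
open scoped LinearPMap SchwartzMap

noncomputable section

namespace CatQubit

/-- The Hilbert space `L²(ℝ, ℂ)`. -/
abbrev L2 : Type := Lp ℂ 2 (volume : Measure ℝ)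

/-! ### Unbounded operators on a complex vector space: products, powers, kernels -/

section Operators

variable {E : Type*} [AddCommGroup E] [Module ℂ E]

/-- The product `B A` of two partially defined operators, on its natural domain
`{x ∈ D(A) | A x ∈ D(B)}`. -/
def pcomp (B A : E →ₗ.[ℂ] E) : E →ₗ.[ℂ] E :=
  B.comp (A.domRestrict ((B.domain.comap A.toFun).map A.domain.subtype)) (by
    rintro ⟨x, hx⟩
    obtain ⟨y, hy, hyx⟩ := hx.1
    have : (A.domRestrict ((B.domain.comap A.toFun).map A.domain.subtype)) ⟨x, hx⟩ = A y :=
      LinearPMap.domRestrict_apply (by simpa using hyx.symm)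
    rw [this]
    exact hy)

theorem mem_pcomp_domain {B A : E →ₗ.[ℂ] E} {x : E} :
    x ∈ (pcomp B A).domain ↔ ∃ h : x ∈ A.domain, A ⟨x, h⟩ ∈ B.domain := by
  constructor
  · rintro ⟨⟨y, hy, rfl⟩, -⟩
    exact ⟨y.2, hy⟩
  · rintro ⟨h, h'⟩
    exact ⟨⟨⟨x, h⟩, h', rfl⟩, h⟩

theorem pcomp_apply {B A : E →ₗ.[ℂ] E} {x : E} (hx : x ∈ (pcomp B A).domain)
    (h : x ∈ A.domain) (h' : A ⟨x, h⟩ ∈ B.domain) :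
    pcomp B A ⟨x, hx⟩ = B ⟨A ⟨x, h⟩, h'⟩ := rfl

/-- The identity operator, defined everywhere. -/
def idOp : E →ₗ.[ℂ] E := (LinearMap.id : E →ₗ[ℂ] E).toPMap ⊤

/-- The powers `Aⁿ` of a partially defined operator, on their natural domains. -/
def ppow (A : E →ₗ.[ℂ] E) : ℕ → (E →ₗ.[ℂ] E)
  | 0 => idOp
  | n + 1 => pcomp A (ppow A n)

/-- The commutator `[A, B] = A B - B A`, on the natural domain `D(A B) ∩ D(B A)`. -/
def comm (A B : E →ₗ.[ℂ] E) : E →ₗ.[ℂ] E := pcomp A B - pcomp B A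

/-- The iterated right commutators: `[A, B]⁽¹⁾ = [A, B]` and
`[A, B]⁽ˢ⁺¹⁾ = [[A, B]⁽ˢ⁾, B]` (with the convention `[A, B]⁽⁰⁾ = A`). -/
def iterComm (A B : E →ₗ.[ℂ] E) : ℕ → (E →ₗ.[ℂ] E)
  | 0 => A
  | s + 1 => comm (iterComm A B s) B

/-- The kernel `{v ∈ D(A) | A v = 0}` of a partially defined operator. -/
def kernel (A : E →ₗ.[ℂ] E) : Submodule ℂ E :=
  (LinearMap.ker A.toFun).map A.domain.subtype

theorem mem_kernel {A : E →ₗ.[ℂ] E} {v : E} :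
    v ∈ kernel A ↔ ∃ h : v ∈ A.domain, A ⟨v, h⟩ = 0 := by
  constructor
  · rintro ⟨y, hy, rfl⟩
    exact ⟨y.2, hy⟩
  · rintro ⟨h, h'⟩
    exact ⟨⟨v, h⟩, h', rfl⟩

end Operators

/-! ### The annihilation operator on `L²(ℝ, ℂ)` -/

/-- The graph of multiplication by the variable `x`: pairs `(f, g)` with `g(x) = x f(x)`. -/
def positionGraph : Submodule ℂ (L2 × L2) where
  carrier := {p | ∀ᵐ x : ℝ, p.2 x = (x : ℂ) * p.1 x}
  zero_mem' := by
    simp only [Set.mem_ofPred_eq, Prod.fst_zero, Prod.snd_zero]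
    filter_upwards [Lp.coeFn_zero ℂ 2 (volume : Measure ℝ)] with x hx
    rw [hx, Pi.zero_apply, mul_zero]
  add_mem' := by
    rintro p q hp hq
    simp only [Set.mem_ofPred_eq, Prod.fst_add, Prod.snd_add] at hp hq ⊢
    filter_upwards [hp, hq, Lp.coeFn_add p.1 q.1, Lp.coeFn_add p.2 q.2] with x h1 h2 h3 h4
    rw [h3, h4, Pi.add_apply, Pi.add_apply, h1, h2, mul_add]
  smul_mem' := by
    rintro c p hp
    simp only [Set.mem_ofPred_eq, Prod.smul_fst, Prod.smul_snd] at hp ⊢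
    filter_upwards [hp, Lp.coeFn_smul c p.1, Lp.coeFn_smul c p.2] with x h1 h2 h3
    rw [h2, h3, Pi.smul_apply, Pi.smul_apply, h1, smul_eq_mul, smul_eq_mul, mul_left_comm]

/-- The graph of `d/dx`: pairs `(f, g)` such that `g` is the derivative of `f` in the sense of
(tempered) distributions. -/
def derivGraph : Submodule ℂ (L2 × L2) where
  carrier := {p | TemperedDistribution.derivCLM ℂ (p.1 : 𝓢'(ℝ, ℂ)) = (p.2 : 𝓢'(ℝ, ℂ))}
  zero_mem' := by
    have h : ((0 : L2) : 𝓢'(ℝ, ℂ)) = 0 :=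
      map_zero (Lp.toTemperedDistributionCLM ℂ (volume : Measure ℝ) 2)
    simp [h]
  add_mem' := by
    rintro p q hp hq
    have h (u v : L2) : ((u + v : L2) : 𝓢'(ℝ, ℂ)) = (u : 𝓢'(ℝ, ℂ)) + (v : 𝓢'(ℝ, ℂ)) :=
      map_add (Lp.toTemperedDistributionCLM ℂ (volume : Measure ℝ) 2) u v
    simp only [Set.mem_ofPred_eq, Prod.fst_add, Prod.snd_add] at hp hq ⊢
    rw [h, h, map_add, hp, hq]
  smul_mem' := by
    rintro c p hp
    have h (u : L2) : ((c • u : L2) : 𝓢'(ℝ, ℂ)) = c • (u : 𝓢'(ℝ, ℂ)) :=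
      map_smul (Lp.toTemperedDistributionCLM ℂ (volume : Measure ℝ) 2) c u
    simp only [Set.mem_ofPred_eq, Prod.smul_fst, Prod.smul_snd] at hp ⊢
    rw [h, h, map_smul, hp]

theorem mem_positionGraph {f g : L2} :
    (f, g) ∈ positionGraph ↔ ∀ᵐ x : ℝ, g x = (x : ℂ) * f x := Iff.rfl

theorem mem_derivGraph {f g : L2} :
    (f, g) ∈ derivGraph ↔
      TemperedDistribution.derivCLM ℂ (f : 𝓢'(ℝ, ℂ)) = (g : 𝓢'(ℝ, ℂ)) := Iff.rfl

/-- Multiplication by `x`, with domain `{f ∈ L² | x f ∈ L²}`. -/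
def position : L2 →ₗ.[ℂ] L2 := positionGraph.toLinearPMap

/-- The operator `d/dx`, with domain the Sobolev space `H¹(ℝ) = {f ∈ L² | f' ∈ L²}`. -/
def ddx : L2 →ₗ.[ℂ] L2 := derivGraph.toLinearPMap

/-- `positionGraph` is the graph of an operator, so that `position` is well defined. -/
theorem position_graph : position.graph = positionGraph := by
  refine Submodule.toLinearPMap_graph_eq _ ?_
  rintro p (hp : ∀ᵐ x : ℝ, p.2 x = (x : ℂ) * p.1 x) h0
  rw [h0] at hp
  refine Lp.ext ?_
  filter_upwards [hp, Lp.coeFn_zero ℂ 2 (volume : Measure ℝ)] with x h1 h2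
  rw [h1, h2, Pi.zero_apply, mul_zero]

/-- `derivGraph` is the graph of an operator, so that `ddx` is well defined. -/
theorem ddx_graph : ddx.graph = derivGraph := by
  refine Submodule.toLinearPMap_graph_eq _ ?_
  rintro p (hp : TemperedDistribution.derivCLM ℂ (p.1 : 𝓢'(ℝ, ℂ)) = (p.2 : 𝓢'(ℝ, ℂ))) h0
  have h : ((0 : L2) : 𝓢'(ℝ, ℂ)) = 0 :=
    map_zero (Lp.toTemperedDistributionCLM ℂ (volume : Measure ℝ) 2)
  rw [h0, h, map_zero] at hp
  have hk := Lp.ker_toTemperedDistributionCLM_eq_bot (F := ℂ) (μ := (volume : Measure ℝ)) (p := 2)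
  exact (LinearMap.ker_eq_bot'.mp hk) p.2 hp.symm

/-- The annihilation operator `a = (x + d/dx) / √2`, with domain
`{f ∈ L² | x f ∈ L² and f' ∈ L²}`. -/
def annihilation : L2 →ₗ.[ℂ] L2 := ((1 / Real.sqrt 2 : ℝ) : ℂ) • (position + ddx)

/-- The operator `L = aᵏ - αᵏ`, with domain `D(aᵏ)`. -/
def opL (α : ℝ) (k : ℕ) : L2 →ₗ.[ℂ] L2 :=
  ppow annihilation k - ((α : ℂ) ^ k) • idOp

/-- Schwartz functions belong to the domain of `a`, which acts on them by
`φ ↦ (x φ + φ') / √2`; in particular `a` maps Schwartz functions to Schwartz functions. -/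
theorem annihilation_schwartz (φ : 𝓢(ℝ, ℂ)) :
    ∃ (h : φ.toLp 2 volume ∈ annihilation.domain) (ψ : 𝓢(ℝ, ℂ)),
      annihilation ⟨φ.toLp 2 volume, h⟩ = ψ.toLp 2 volume ∧
      ∀ x : ℝ, ψ x = ((1 / Real.sqrt 2 : ℝ) : ℂ) * (x * φ x + deriv φ x) := by
  have hx : (fun x : ℝ => (x : ℂ)).HasTemperateGrowth := by fun_prop
  set ξ : 𝓢(ℝ, ℂ) := SchwartzMap.smulLeftCLM ℂ (fun x : ℝ => (x : ℂ)) φ with hξ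
  set δ : 𝓢(ℝ, ℂ) := SchwartzMap.derivCLM ℂ ℂ φ with hδ
  have h1 : ((φ.toLp 2 volume : L2), (ξ.toLp 2 volume : L2)) ∈ position.graph := by
    rw [position_graph, mem_positionGraph]
    filter_upwards [φ.coeFn_toLp 2 volume, ξ.coeFn_toLp 2 volume] with x h1 h2
    rw [h1, h2, hξ, SchwartzMap.smulLeftCLM_apply_apply hx, smul_eq_mul]
  have h2 : ((φ.toLp 2 volume : L2), (δ.toLp 2 volume : L2)) ∈ ddx.graph := by
    rw [ddx_graph]
    rw [mem_derivGraph, Lp.toTemperedDistribution_toLp_eq, Lp.toTemperedDistribution_toLp_eq]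
    exact TemperedDistribution.derivCLM_toTemperedDistributionCLM_eq ℂ φ
  rw [LinearPMap.mem_graph_iff] at h1 h2
  obtain ⟨⟨y, hy⟩, rfl, hy2⟩ := h1
  obtain ⟨⟨z, hz⟩, hz1, hz2⟩ := h2
  dsimp only at hz1
  subst hz1
  refine ⟨⟨hy, hz⟩, ((1 / Real.sqrt 2 : ℝ) : ℂ) • (ξ + δ), ?_, ?_⟩
  · change ((1 / Real.sqrt 2 : ℝ) : ℂ) • (position ⟨_, hy⟩ + ddx ⟨_, hz⟩) = _
    rw [hy2, hz2]
    change _ = SchwartzMap.toLpCLM ℂ ℂ 2 volume _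
    rw [map_smul, map_add]
    rfl
  · intro x
    change ((1 / Real.sqrt 2 : ℝ) : ℂ) * (ξ x + δ x) = _
    rw [hξ, SchwartzMap.smulLeftCLM_apply_apply hx, smul_eq_mul]
    rfl

/-- The domain of `L` is dense, so that its adjoint `L†` is a genuine adjoint. -/
theorem dense_opL_domain (α : ℝ) (k : ℕ) : Dense ((opL α k).domain : Set L2) := by
  have key : ∀ (n : ℕ) (φ : 𝓢(ℝ, ℂ)), ∃ (h : φ.toLp 2 volume ∈ (ppow annihilation n).domain)
      (ψ : 𝓢(ℝ, ℂ)), ppow annihilation n ⟨φ.toLp 2 volume, h⟩ = ψ.toLp 2 volume := by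
    intro n φ
    induction n with
    | zero => exact ⟨Submodule.mem_top, φ, rfl⟩
    | succ n ih =>
      obtain ⟨h, ψ, hψ⟩ := ih
      obtain ⟨h', χ, hχ, -⟩ := annihilation_schwartz ψ
      have h'' : ppow annihilation n ⟨φ.toLp 2 volume, h⟩ ∈ annihilation.domain := by rwa [hψ]
      refine ⟨mem_pcomp_domain.mpr ⟨h, h''⟩, χ, ?_⟩
      rw [← hχ]
      exact (pcomp_apply _ h h'').trans (by congr 1; exact Subtype.ext hψ)
  have hd : DenseRange (SchwartzMap.toLpCLM ℂ ℂ 2 (volume : Measure ℝ) : 𝓢(ℝ, ℂ) → L2) :=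
    SchwartzMap.denseRange_toLpCLM (by norm_num)
  refine Dense.mono ?_ hd
  rintro _ ⟨φ, rfl⟩
  exact ⟨(key k φ).1, Submodule.mem_top⟩

/-! ### The two subspaces attached to an operator `L` -/

section Spans

variable {H : Type*} [NormedAddCommGroup H] [InnerProductSpace ℂ H] [CompleteSpace H]

/-- The span of the vectors `(L†)ʲ v`, for `j ∈ ℕ` and `v ∈ ker L`. -/
def spanA (L : H →ₗ.[ℂ] H) : Submodule ℂ H :=
  Submodule.span ℂ {w | ∃ j : ℕ, ∃ v : (ppow (L†) j).domain,
    (v : H) ∈ kernel L ∧ w = ppow (L†) j v}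

/-- The span of the vectors `(L†)ʲ [L, L†]⁽ˢ⁾ v`, for `j ∈ ℕ`, `1 ≤ s ≤ k - 1` and `v ∈ ker L`. -/
def spanSharp (L : H →ₗ.[ℂ] H) (k : ℕ) : Submodule ℂ H :=
  Submodule.span ℂ {w | ∃ j s : ℕ, 1 ≤ s ∧ s ≤ k - 1 ∧
    ∃ v : (pcomp (ppow (L†) j) (iterComm L (L†) s)).domain,
      (v : H) ∈ kernel L ∧ w = pcomp (ppow (L†) j) (iterComm L (L†) s) v}

end Spans

end CatQubit

end

namespace CatQubit

section Algebra

open Polynomial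

/-! ### Polynomials: finite differences and spanning families -/

/-! Write `A`, `C` for annihilation and creation. The coherent states `cohS w`, normalised so as to
be holomorphic in `w`, satisfy `A (cohS w) = w • cohS w`, and `C` acts on them as `d/dw`. Hence for
`f` in `L2` the functions `F n w = ⟪f, C ^ n (cohS w)⟫` are the successive derivatives of one entire
function `F 0`, and `F 0 = 0` forces `f = 0` because coherent states are complete.

Let `f` be orthogonal to both spans, and let `β` run over the `k`-th roots of `α ^ k`, whose
coherent states lie in the kernel. The first span gives `F (k * j) β = 0` for all `β` and `j`. For
the second, the `s`-th commutator is `C ^ (k * (s - 1))` times a polynomial of degree `k - s` in the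
number operator `C * A` (`weylComm_succ`). With the constants coming from the first span, all
degrees below `k` occur, so at one root `F n` vanishes for every `n ≥ k * k`
(`functional_creation_pow_eq_zero`). By Taylor expansion `F (k * N)` is zero for large `N`. If `F (k
* (j + 1))` is zero, then `F (k * j)` is a polynomial of degree less than `k` with `k` distinct
roots, hence zero; descending to `j = 0` gives `F 0 = 0` (`tower_eq_zero`).

For the domains, a discrete Fourier sum over the roots splits a kernel vector into eigenvectors of
`A`, which are multiples of coherent states. The kernel therefore consists of Schwartz functions, a
space stable under all the operators involved, where commutators may be computed algebraically. -/

/-- The finite difference `Q(X + r) - Q(X)`. -/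
noncomputable def polyDiff (r : ℂ) (Q : ℂ[X]) : ℂ[X] := taylor r Q - Q

theorem natDegree_polyDiff {r : ℂ} (hr : r ≠ 0) {Q : ℂ[X]} {d : ℕ} (hQ : Q.natDegree = d + 1) :
    (polyDiff r Q).natDegree = d := by
  have hdeg : (polyDiff r Q).natDegree < d + 1 := by
    have h0 : Q ≠ 0 := by rintro rfl; simp at hQ
    by_cases h : polyDiff r Q = 0
    · simp [h]
    · rw [← hQ, ← natDegree_taylor Q r]
      exact natDegree_lt_natDegree h (degree_sub_lt_left (degree_taylor Q r)
        (by rwa [Ne, taylor_eq_zero]) (leadingCoeff_taylor r Q))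
  -- The `d`-th Hasse derivative of `Q` has degree at most one; its constant term cancels against
  -- `Q.coeff d`.
  have hcoeff : (polyDiff r Q).coeff d = (d + 1) * Q.leadingCoeff * r := by
    rw [polyDiff, coeff_sub, taylor_coeff, eval_eq_sum_range' (n := 2)]
    · simp [Finset.sum_range_succ, hasseDeriv_coeff, leadingCoeff, hQ, add_comm 1 d]
    · refine lt_of_le_of_lt (natDegree_hasseDeriv_le _ _) ?_
      omega
  refine le_antisymm (by omega) (le_natDegree_of_ne_zero ?_)
  rw [hcoeff]
  have : Q ≠ 0 := by rintro rfl; simp at hQ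
  have : (d : ℂ) + 1 ≠ 0 := by exact_mod_cast Nat.succ_ne_zero d
  simp_all

/-- Triangular elimination: a multiple of the member of top degree removes the leading term. -/
theorem mem_of_natDegree_family {k : ℕ} (U : Submodule ℂ ℂ[X])
    (h : ∀ d < k, ∃ Q ∈ U, Q ≠ 0 ∧ Q.natDegree = d) (P : ℂ[X]) (hP : P.degree < k) : P ∈ U := by
  induction k generalizing P with
  | zero =>
    have : P = 0 := ext fun n => (degree_lt_iff_coeff_zero P 0).mp hP n n.zero_le
    exact this ▸ U.zero_mem
  | succ k ih =>
    obtain ⟨Q, hQU, hQ0, hQ⟩ := h k k.lt_succ_self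
    have hlc : Q.coeff k ≠ 0 := by
      rw [← hQ]
      exact leadingCoeff_ne_zero.mpr hQ0
    have hmem : P - (P.coeff k / Q.coeff k) • Q ∈ U := by
      refine ih (fun d hd => h d (hd.trans k.lt_succ_self)) _ ?_
      rw [degree_lt_iff_coeff_zero]
      intro m hm
      rw [coeff_sub, coeff_smul, smul_eq_mul]
      rcases hm.eq_or_lt with rfl | hm
      · rw [div_mul_cancel₀ _ hlc, sub_self]
      · rw [coeff_eq_zero_of_natDegree_lt (hQ.trans_lt hm), mul_zero, sub_zero]
        exact (degree_lt_iff_coeff_zero _ _).mp hP m hm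
    simpa using U.add_mem hmem (U.smul_mem (P.coeff k / Q.coeff k) hQU)

/-! ### The Weyl algebra -/

section Weyl

variable {R : Type*} [Ring R] [Algebra ℂ R] {A C : R}

/-- Creation raises the number operator by one: `(C * A) * C = C * (C * A + 1)`. -/
theorem aeval_number_mul_creation (h : A * C = C * A + 1) (Q : ℂ[X]) :
    aeval (C * A) Q * C = C * aeval (C * A) (taylor 1 Q) := by
  induction Q using Polynomial.induction_on' with
  | add p q hp hq => simp only [map_add, add_mul, mul_add, hp, hq]
  | monomial n a =>
    have hs : SemiconjBy C (C * A + 1) (C * A) := by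
      rw [SemiconjBy, mul_assoc (C : R) A C, h]
    rw [taylor_monomial, ← C_mul_X_pow_eq_monomial]
    simp only [map_mul, aeval_C, map_pow, aeval_X, map_add, map_one]
    rw [mul_assoc, ← (hs.pow_right n).eq, ← mul_assoc, ← mul_assoc, Algebra.commutes]

theorem aeval_number_mul_creation_pow (h : A * C = C * A + 1) (Q : ℂ[X]) (n : ℕ) :
    aeval (C * A) Q * C ^ n = C ^ n * aeval (C * A) (taylor (n : ℂ) Q) := by
  induction n generalizing Q with
  | zero => simp
  | succ n ih =>
    rw [pow_succ', ← mul_assoc, aeval_number_mul_creation h, mul_assoc, ih, taylor_taylor,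
      ← mul_assoc, Nat.cast_succ]

theorem creation_pow_mul_annihilation_pow (h : A * C = C * A + 1) (n : ℕ) :
    C ^ n * A ^ n = aeval (C * A) (descPochhammer ℂ n) := by
  induction n with
  | zero => simp
  | succ n ih =>
    have h1 := aeval_number_mul_creation_pow h (X - (n : ℂ[X])) n
    rw [map_sub (taylor _), taylor_X, ← C_eq_natCast, taylor_C, add_sub_cancel_right, aeval_X] at h1
    rw [descPochhammer_succ_right, mul_comm, map_mul, ← ih, ← C_eq_natCast, ← mul_assoc, h1,
      pow_succ, pow_succ']
    simp only [mul_assoc]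

theorem annihilation_pow_mul_creation_pow (h : A * C = C * A + 1) (n : ℕ) :
    A ^ n * C ^ n = aeval (C * A) (taylor (n : ℂ) (descPochhammer ℂ n)) := by
  induction n with
  | zero => simp
  | succ n ih =>
    have h1 := aeval_number_mul_creation_pow h (X + 1) n
    rw [map_add, map_add, taylor_X, taylor_one, aeval_X, map_one] at h1
    have h2 : taylor ((n + 1 : ℕ) : ℂ) (descPochhammer ℂ (n + 1)) =
        taylor (n : ℂ) (descPochhammer ℂ n) * (X + Polynomial.C (n : ℂ) + Polynomial.C 1) := by
      rw [descPochhammer_succ_left, taylor_mul, taylor_X, mul_comm, taylor_apply, taylor_apply,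
        comp_assoc, sub_comp, X_comp, one_comp, Nat.cast_succ, C_add, C_1, ← add_assoc,
        add_sub_cancel_right]
    rw [h2, map_mul, ← ih, pow_succ, pow_succ', mul_assoc, ← mul_assoc A, h, h1]
    simp only [mul_assoc]

/-- The iterated commutators of `A ^ k - c` with `C ^ k - c`. -/
def weylComm (A C : R) (c : ℂ) (k : ℕ) : ℕ → R
  | 0 => A ^ k - c • 1
  | s + 1 => weylComm A C c k s * (C ^ k - c • 1) - (C ^ k - c • 1) * weylComm A C c k s

/-- The scalars `c` drop out of every commutator. The first one is the difference of `A ^ k * C ^ k`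
and `C ^ k * A ^ k`, which are the falling factorial of the number operator with and without a shift
by `k`. Each further commutator moves one `C ^ k` to the left and applies the finite difference
again. -/
theorem weylComm_succ (h : A * C = C * A + 1) (c : ℂ) (k s : ℕ) :
    weylComm A C c k (s + 1) =
      C ^ (k * s) * aeval (C * A) ((polyDiff k)^[s + 1] (descPochhammer ℂ k)) := by
  induction s with
  | zero =>
    simp only [weylComm, Function.iterate_one, polyDiff, map_sub, mul_zero, zero_add, pow_zero, one_mul,
      ← annihilation_pow_mul_creation_pow h, ← creation_pow_mul_annihilation_pow h]
    simp only [sub_mul, mul_sub, smul_mul_assoc, mul_smul_comm, one_mul, mul_one]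
    module
  | succ s ih =>
    rw [weylComm, ih, Function.iterate_succ_apply' _ (s + 1), polyDiff, map_sub, mul_sub]
    set Q := (polyDiff k)^[s + 1] (descPochhammer ℂ k)
    have h1 := aeval_number_mul_creation_pow h Q k
    rw [mul_sub, sub_mul, mul_assoc, h1, Nat.mul_succ, pow_add]
    rw [show C ^ k * (C ^ (k * s) * aeval (C * A) Q) = C ^ (k * s) * C ^ k * aeval (C * A) Q by
      rw [← mul_assoc, ← pow_add, ← pow_add, add_comm]]
    simp only [smul_mul_assoc, mul_smul_comm, one_mul, mul_one, mul_assoc]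
    abel

theorem natDegree_iterate_polyDiff {k : ℕ} (s : ℕ) (hs : s ≤ k) :
    ((polyDiff k)^[s] (descPochhammer ℂ k)).natDegree = k - s := by
  induction s with
  | zero => simp [descPochhammer_natDegree]
  | succ s ih =>
    rw [Function.iterate_succ_apply']
    refine natDegree_polyDiff (by norm_cast; omega) ?_
    rw [ih (by omega)]
    omega

end Weyl

/-! ### Functionals annihilating the two spans -/

section Functional

variable {V : Type*} [AddCommGroup V] [Module ℂ V] {A C : Module.End ℂ V}

theorem functional_pow_eq_zero (ℓ : V →ₗ[ℂ] ℂ) (B : Module.End ℂ V) (c : ℂ) {v : V}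
    (h : ∀ j : ℕ, ℓ (((B - c • 1) ^ j) v) = 0) (j : ℕ) : ℓ ((B ^ j) v) = 0 := by
  have hB : B = (B - c • 1) + c • 1 := by abel
  have hc : Commute (B - c • 1) (c • (1 : Module.End ℂ V)) :=
    (Commute.one_right _).smul_right c
  rw [hB, hc.add_pow]
  simp only [LinearMap.sum_apply, map_sum]
  refine Finset.sum_eq_zero fun m _ => ?_
  have : ((B - c • 1) ^ m * (c • (1 : Module.End ℂ V)) ^ (j - m) *
      ((j.choose m : ℕ) : Module.End ℂ V)) = (c ^ (j - m) * (j.choose m : ℂ)) • (B - c • 1) ^ m := by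
    rw [_root_.smul_pow, one_pow, ← nsmul_eq_mul', mul_smul_comm, mul_one, ← Nat.cast_smul_eq_nsmul ℂ,
      smul_smul, mul_comm]
  rw [this, LinearMap.smul_apply, map_smul, h, smul_zero]

/-- With `n = k * J + r`, the vector `C ^ n v` is, up to the factor `β ^ r`, equal to `C ^ (k * J)`
applied to `C ^ r A ^ r v`, and `C ^ r A ^ r` is a polynomial of degree `r < k` in the number
operator. It suffices to kill all such polynomials. -/
theorem functional_creation_pow_eq_zero (h : A * C = C * A + 1) {β : ℂ} (hβ : β ≠ 0) {v : V}
    (hv : A v = β • v) (ℓ : V →ₗ[ℂ] ℂ) (c : ℂ) {k : ℕ} (hk : 0 < k)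
    (h0 : ∀ j : ℕ, ℓ (((C ^ k - c • 1) ^ j) v) = 0)
    (h1 : ∀ j s : ℕ, 1 ≤ s → s ≤ k - 1 → ℓ (((C ^ k - c • 1) ^ j) (weylComm A C c k s v)) = 0)
    {n : ℕ} (hn : k * k ≤ n) : ℓ ((C ^ n) v) = 0 := by
  have hAm (m : ℕ) : (A ^ m) v = β ^ m • v := by
    induction m with
    | zero => simp
    | succ m ih => rw [pow_succ, Module.End.mul_apply, hv, map_smul, ih, smul_smul, pow_succ']
  set J := n / k with hJ
  -- The commutator of order `s + 1` already carries `C ^ (k * s)`, so `J - s` further factors `C ^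
  -- k` are needed; the bound on `J` makes this a true subtraction.
  have hJk : k ≤ J := (Nat.le_div_iff_mul_le hk).mpr hn
  let U : Submodule ℂ ℂ[X] := LinearMap.ker
    (ℓ ∘ₗ (C ^ (k * J)) ∘ₗ LinearMap.applyₗ v ∘ₗ (aeval (C * A)).toLinearMap)
  have hU (P : ℂ[X]) : P ∈ U ↔ ℓ ((C ^ (k * J)) (aeval (C * A) P v)) = 0 := Iff.rfl
  have hdesc : descPochhammer ℂ (n % k) ∈ U := by
    refine mem_of_natDegree_family (k := k) U ?_ _ ?_
    -- Degree `0` comes from `h0`; degree `d > 0` comes from the commutator of order `k - d`.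
    · intro d hd
      rcases Nat.eq_zero_or_pos d with rfl | hd0
      · refine ⟨1, ?_, one_ne_zero, natDegree_one⟩
        rw [hU, map_one, Module.End.one_apply, pow_mul]
        exact functional_pow_eq_zero ℓ _ c h0 J
      · obtain ⟨s, hs⟩ : ∃ s, k - d = s + 1 := ⟨k - d - 1, by omega⟩
        have hdeg := natDegree_iterate_polyDiff (k := k) (s + 1) (by omega)
        refine ⟨_, ?_, ?_, hdeg.trans (by omega)⟩
        · rw [hU]
          have h2 := functional_pow_eq_zero ℓ _ c (fun j => h1 j (s + 1) (by omega) (by omega)) (J - s)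
          rw [weylComm_succ h, ← pow_mul, ← Module.End.mul_apply, ← mul_assoc, ← pow_add,
            ← mul_add, Nat.sub_add_cancel (by omega)] at h2
          exact h2
        · intro h0
          rw [h0, natDegree_zero] at hdeg
          omega
    · refine degree_le_natDegree.trans_lt ?_
      rw [descPochhammer_natDegree]
      exact_mod_cast Nat.mod_lt _ hk
  rw [hU, ← creation_pow_mul_annihilation_pow h, Module.End.mul_apply, hAm, map_smul, map_smul,
    map_smul, ← Module.End.mul_apply, ← pow_add, Nat.div_add_mod, smul_eq_mul] at hdesc
  exact (mul_eq_zero.mp hdesc).resolve_left (pow_ne_zero _ hβ)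

end Functional

end Algebra

noncomputable section

open scoped ComplexConjugate ContDiff

/-! ### Partially defined operators extending an endomorphism of an invariant subspace -/

section Extends

variable {E V : Type*} [AddCommGroup E] [Module ℂ E] [AddCommGroup V] [Module ℂ V]
  {ι : V →ₗ[ℂ] E}

/-- `T` is defined on the range of `ι`, where it acts as the endomorphism `S`. -/
def Extends (ι : V →ₗ[ℂ] E) (T : E →ₗ.[ℂ] E) (S : Module.End ℂ V) : Prop :=
  ∀ φ : V, ∃ h : ι φ ∈ T.domain, T ⟨ι φ, h⟩ = ι (S φ)

theorem Extends.pcomp {T T' : E →ₗ.[ℂ] E} {S S' : Module.End ℂ V} (h : Extends ι T S)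
    (h' : Extends ι T' S') : Extends ι (pcomp T T') (S * S') := fun φ => by
  obtain ⟨h1, h2⟩ := h' φ
  obtain ⟨h3, h4⟩ := h (S' φ)
  have h5 : T' ⟨ι φ, h1⟩ ∈ T.domain := by rwa [h2]
  refine ⟨mem_pcomp_domain.mpr ⟨h1, h5⟩, ?_⟩
  rw [pcomp_apply _ h1 h5, Module.End.mul_apply, ← h4]
  congr 1
  exact Subtype.ext h2

theorem extends_idOp : Extends ι idOp 1 := fun _ => ⟨Submodule.mem_top, rfl⟩

theorem Extends.ppow {T : E →ₗ.[ℂ] E} {S : Module.End ℂ V} (h : Extends ι T S) (n : ℕ) :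
    Extends ι (ppow T n) (S ^ n) := by
  induction n with
  | zero => exact extends_idOp
  | succ n ih =>
    rw [pow_succ']
    exact h.pcomp ih

theorem Extends.sub {T T' : E →ₗ.[ℂ] E} {S S' : Module.End ℂ V} (h : Extends ι T S)
    (h' : Extends ι T' S') : Extends ι (T - T') (S - S') := fun φ => by
  obtain ⟨h1, h2⟩ := h φ
  obtain ⟨h3, h4⟩ := h' φ
  refine ⟨⟨h1, h3⟩, ?_⟩
  rw [LinearMap.sub_apply, map_sub, ← h2, ← h4]
  rfl

theorem Extends.smul {T : E →ₗ.[ℂ] E} {S : Module.End ℂ V} (h : Extends ι T S) (c : ℂ) :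
    Extends ι (c • T) (c • S) := fun φ => by
  obtain ⟨h1, h2⟩ := h φ
  refine ⟨h1, ?_⟩
  rw [LinearMap.smul_apply, map_smul, ← h2]
  rfl

theorem Extends.iterComm {T : E →ₗ.[ℂ] E} {A C : Module.End ℂ V} {T' : E →ₗ.[ℂ] E} {c : ℂ} {k : ℕ}
    (h : Extends ι T (A ^ k - c • 1)) (h' : Extends ι T' (C ^ k - c • 1)) (s : ℕ) :
    Extends ι (iterComm T T' s) (weylComm A C c k s) := by
  induction s with
  | zero => exact h
  | succ s ih => exact (ih.pcomp h').sub (h'.pcomp ih)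

end Extends

/-! ### The ladder operators on Schwartz functions -/

/-- Schwartz functions as elements of `L²(ℝ, ℂ)`. -/
def toL2 : 𝓢(ℝ, ℂ) →ₗ[ℂ] L2 := (SchwartzMap.toLpCLM ℂ ℂ 2 (volume : Measure ℝ)).toLinearMap

theorem coeFn_toL2 (φ : 𝓢(ℝ, ℂ)) : toL2 φ =ᵐ[volume] φ := φ.coeFn_toLp 2 volume

/-- Multiplication by `x` on Schwartz functions. -/
def mulX : Module.End ℂ 𝓢(ℝ, ℂ) :=
  (SchwartzMap.smulLeftCLM ℂ (fun x : ℝ => (x : ℂ))).toLinearMap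

/-- Differentiation of Schwartz functions. -/
def derivS : Module.End ℂ 𝓢(ℝ, ℂ) := (SchwartzMap.derivCLM ℂ ℂ).toLinearMap

theorem mulX_apply (φ : 𝓢(ℝ, ℂ)) (x : ℝ) : mulX φ x = x * φ x := by
  have hx : (fun x : ℝ => (x : ℂ)).HasTemperateGrowth := by fun_prop
  exact SchwartzMap.smulLeftCLM_apply_apply hx φ x

theorem derivS_apply (φ : 𝓢(ℝ, ℂ)) (x : ℝ) : derivS φ x = deriv φ x := rfl

/-- The normalisation constant `1 / √2` of the ladder operators. -/
abbrev invSqrtTwo : ℂ := ((1 / Real.sqrt 2 : ℝ) : ℂ)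

theorem invSqrtTwo_mul_self : invSqrtTwo * invSqrtTwo = 1 / 2 := by
  rw [← Complex.ofReal_mul, div_mul_div_comm, Real.mul_self_sqrt (by norm_num)]
  norm_num

theorem conj_invSqrtTwo : conj invSqrtTwo = invSqrtTwo := Complex.conj_ofReal _

/-- The annihilation operator on Schwartz functions. -/
def annS : Module.End ℂ 𝓢(ℝ, ℂ) := invSqrtTwo • (mulX + derivS)

/-- The creation operator on Schwartz functions. -/
def creS : Module.End ℂ 𝓢(ℝ, ℂ) := invSqrtTwo • (mulX - derivS)

theorem derivS_mul_mulX : derivS * mulX = mulX * derivS + 1 := by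
  refine LinearMap.ext fun φ => SchwartzMap.ext fun x => ?_
  have h : ⇑(mulX φ) = fun y : ℝ => (y : ℂ) * φ y := funext (mulX_apply φ)
  have h1 : HasDerivAt (fun y : ℝ => (y : ℂ) * φ y) (1 * φ x + x * deriv φ x) x :=
    (Complex.ofRealCLM.hasDerivAt (x := x)).mul (φ.hasDerivAt x)
  change deriv (mulX φ) x = mulX (derivS φ) x + φ x
  rw [h, h1.deriv, mulX_apply, derivS_apply]
  ring

theorem annS_mul_creS : annS * creS = creS * annS + 1 := by
  have h : annS * creS = creS * annS + (2 * (invSqrtTwo * invSqrtTwo)) • (derivS * mulX - mulX * derivS) := by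
    simp only [annS, creS, smul_mul_assoc, mul_smul_comm, mul_add, add_mul, mul_sub, sub_mul]
    module
  rw [h, derivS_mul_mulX, invSqrtTwo_mul_self]
  norm_num

theorem extends_annihilation : Extends toL2 annihilation annS := fun φ => by
  obtain ⟨h, ψ, hψ, hx⟩ := annihilation_schwartz φ
  refine ⟨h, hψ.trans ?_⟩
  change toL2 ψ = _
  congr 1
  ext x
  rw [hx, ← derivS_apply, ← mulX_apply]
  rfl

theorem extends_opL (α : ℝ) (k : ℕ) :
    Extends toL2 (opL α k) (annS ^ k - ((α : ℂ) ^ k) • 1) :=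
  (extends_annihilation.ppow k).sub (extends_idOp.smul _)

theorem inner_toL2 (φ : 𝓢(ℝ, ℂ)) (u : L2) : inner ℂ (toL2 φ) u = ∫ x, conj (φ x) * u x := by
  rw [L2.inner_def]
  refine integral_congr_ae ?_
  filter_upwards [coeFn_toL2 φ] with x hx
  rw [hx, RCLike.inner_apply, mul_comm]

/-- Complex conjugation of Schwartz functions. -/
def conjS (φ : 𝓢(ℝ, ℂ)) : 𝓢(ℝ, ℂ) :=
  SchwartzMap.postcompCLM (𝕜 := ℝ) (Complex.conjCLE : ℂ →L[ℝ] ℂ) φ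

theorem conjS_apply (φ : 𝓢(ℝ, ℂ)) (x : ℝ) : conjS φ x = conj (φ x) := rfl

theorem inner_toL2_position (φ : 𝓢(ℝ, ℂ)) {u g : L2} (h : (u, g) ∈ positionGraph) :
    inner ℂ (toL2 φ) g = inner ℂ (toL2 (mulX φ)) u := by
  rw [inner_toL2, inner_toL2]
  refine integral_congr_ae ?_
  filter_upwards [mem_positionGraph.mp h] with x hx
  rw [hx, mulX_apply, map_mul, Complex.conj_ofReal]
  ring

theorem inner_toL2_ddx (φ : 𝓢(ℝ, ℂ)) {u g : L2} (h : (u, g) ∈ derivGraph) :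
    inner ℂ (toL2 φ) g = -inner ℂ (toL2 (derivS φ)) u := by
  have h1 := congrArg (fun T : 𝓢'(ℝ, ℂ) => T (conjS φ)) (mem_derivGraph.mp h)
  simp only [TemperedDistribution.derivCLM_apply_apply, Lp.toTemperedDistribution_apply,
    conjS_apply, smul_eq_mul] at h1
  rw [inner_toL2, inner_toL2, ← h1, ← integral_neg]
  refine integral_congr_ae (Filter.Eventually.of_forall fun x => ?_)
  have h2 : HasDerivAt (conjS φ) (conj (deriv φ x)) x :=
    ((Complex.conjCLE : ℂ →L[ℝ] ℂ).hasFDerivAt.comp_hasDerivAt x (φ.hasDerivAt x))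
  change -(deriv (conjS φ) x) * u x = -(conj (derivS φ x) * u x)
  rw [h2.deriv, derivS_apply, neg_mul]

/-- Only the test function is Schwartz: the weak definition of the derivative allows any `u` in the
domain. -/
theorem inner_toL2_annihilation (φ : 𝓢(ℝ, ℂ)) (u : annihilation.domain) :
    inner ℂ (toL2 φ) (annihilation u) = inner ℂ (toL2 (creS φ)) (u : L2) := by
  obtain ⟨u, hu⟩ := u
  have hp : (u, position ⟨u, hu.1⟩) ∈ positionGraph := by
    rw [← position_graph]
    exact position.mem_graph ⟨u, hu.1⟩
  have hd : (u, ddx ⟨u, hu.2⟩) ∈ derivGraph := by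
    rw [← ddx_graph]
    exact ddx.mem_graph ⟨u, hu.2⟩
  change inner ℂ (toL2 φ) (invSqrtTwo • (position ⟨u, hu.1⟩ + ddx ⟨u, hu.2⟩)) = _
  rw [inner_smul_right, inner_add_right, inner_toL2_position φ hp, inner_toL2_ddx φ hd, creS,
    LinearMap.smul_apply, LinearMap.sub_apply, map_smul, map_sub, inner_smul_left, inner_sub_left,
    conj_invSqrtTwo, sub_eq_add_neg]

theorem inner_toL2_ppow_annihilation (φ : 𝓢(ℝ, ℂ)) (n : ℕ) (u : (ppow annihilation n).domain) :
    inner ℂ (toL2 φ) (ppow annihilation n u) = inner ℂ (toL2 ((creS ^ n) φ)) (u : L2) := by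
  induction n generalizing φ with
  | zero => rfl
  | succ n ih =>
    obtain ⟨u, hu⟩ := u
    obtain ⟨h, h'⟩ := mem_pcomp_domain.mp hu
    have h1 : ppow annihilation (n + 1) ⟨u, hu⟩ = annihilation ⟨ppow annihilation n ⟨u, h⟩, h'⟩ :=
      pcomp_apply hu h h'
    rw [h1, inner_toL2_annihilation, ih, pow_succ, Module.End.mul_apply]

/-- The pairing identity gives both membership in the adjoint domain and the value. Since `α` is
real, the constant is its own conjugate. -/
theorem extends_adjoint_opL (α : ℝ) (k : ℕ) :
    Extends toL2 ((opL α k)†) (creS ^ k - ((α : ℂ) ^ k) • 1) := fun φ => by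
  have key (u : (opL α k).domain) :
      inner ℂ (toL2 ((creS ^ k - ((α : ℂ) ^ k) • 1) φ)) (u : L2) =
        inner ℂ (toL2 φ) (opL α k u) := by
    obtain ⟨u, hu⟩ := u
    change _ = inner ℂ (toL2 φ) (ppow annihilation k ⟨u, hu.1⟩ - ((α : ℂ) ^ k) • u)
    rw [inner_sub_right, inner_toL2_ppow_annihilation, inner_smul_right, LinearMap.sub_apply,
      map_sub, inner_sub_left, LinearMap.smul_apply, map_smul, inner_smul_left, map_pow,
      Complex.conj_ofReal, Module.End.one_apply]
  have hmem := LinearPMap.mem_adjoint_domain_of_exists (T := opL α k) (toL2 φ) ⟨_, key⟩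
  exact ⟨hmem, LinearPMap.adjoint_apply_eq (dense_opL_domain α k) ⟨_, hmem⟩ key⟩

/-! ### Coherent states -/

/-- The constant `√2`, as a complex number. -/
abbrev sqrtTwo : ℂ := ((Real.sqrt 2 : ℝ) : ℂ)

theorem sqrtTwo_mul_self : sqrtTwo * sqrtTwo = 2 := by
  rw [← Complex.ofReal_mul, Real.mul_self_sqrt (by norm_num)]
  norm_num

theorem invSqrtTwo_eq : invSqrtTwo = sqrtTwo / 2 := by
  have h : sqrtTwo ≠ 0 := fun h => by simpa [h] using sqrtTwo_mul_self
  rw [invSqrtTwo, Complex.ofReal_div, Complex.ofReal_one, div_eq_div_iff h two_ne_zero, one_mul,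
    sqrtTwo_mul_self]

/-- The (unnormalised) coherent state of parameter `w`, as a function. -/
def cohFun (w : ℂ) (x : ℝ) : ℂ := Complex.exp (-(x : ℂ) ^ 2 / 2 + sqrtTwo * w * x - w ^ 2 / 2)

/-- A polynomial in `√2 x - w` times the coherent state of parameter `w`. -/
def polyCoh (P : Polynomial ℂ) (w : ℂ) (x : ℝ) : ℂ := P.eval (sqrtTwo * x - w) * cohFun w x

theorem exists_norm_eval_le_mul_exp (P : Polynomial ℂ) :
    ∃ K : ℝ, 0 ≤ K ∧ ∀ z : ℂ, ‖P.eval z‖ ≤ K * Real.exp ‖z‖ := by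
  induction P using Polynomial.induction_on' with
  | add p q hp hq =>
    obtain ⟨K, hK, h⟩ := hp
    obtain ⟨K', hK', h'⟩ := hq
    refine ⟨K + K', by positivity, fun z => ?_⟩
    rw [Polynomial.eval_add, add_mul]
    exact (norm_add_le _ _).trans (add_le_add (h z) (h' z))
  | monomial n a =>
    refine ⟨‖a‖ * n.factorial, by positivity, fun z => ?_⟩
    rw [Polynomial.eval_monomial, norm_mul, norm_pow, mul_assoc]
    have h := Real.pow_div_factorial_le_exp ‖z‖ (norm_nonneg z) n
    rw [div_le_iff₀ (by positivity)] at h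
    rw [mul_comm (n.factorial : ℝ)]
    gcongr

theorem norm_cohFun (w : ℂ) (x : ℝ) :
    ‖cohFun w x‖ = Real.exp (-x ^ 2 / 2 + Real.sqrt 2 * w.re * x - (w ^ 2).re / 2) := by
  rw [cohFun, Complex.norm_exp]
  congr 1
  have h1 : (-(x : ℂ) ^ 2 / 2).re = -x ^ 2 / 2 := by
    rw [show (-(x : ℂ) ^ 2 / 2) = ((-x ^ 2 / 2 : ℝ) : ℂ) by push_cast; ring, Complex.ofReal_re]
  have h2 : (w ^ 2 / 2).re = (w ^ 2).re / 2 := by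
    rw [show w ^ 2 / 2 = w ^ 2 / ((2 : ℝ) : ℂ) by norm_num, Complex.div_ofReal_re]
  rw [Complex.sub_re, Complex.add_re, h1, h2, Complex.re_mul_ofReal, Complex.re_ofReal_mul]

/-- Coherent states times polynomials have Gaussian decay, locally uniformly in the parameter. -/
theorem exists_norm_polyCoh_le (P : Polynomial ℂ) (R : ℝ) :
    ∃ K : ℝ, 0 ≤ K ∧ ∀ w : ℂ, ‖w‖ ≤ R → ∀ x : ℝ, ‖polyCoh P w x‖ ≤ K * Real.exp (-x ^ 2 / 4) := by
  obtain ⟨K, hK, h⟩ := exists_norm_eval_le_mul_exp P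
  -- `b` is the total coefficient of `|x|`: `√2` from the exponential bound on the polynomial and
  -- `√2 * R` from the coherent state. Half of the Gaussian exponent then absorbs `b * |x|`.
  set b := Real.sqrt 2 * (1 + R)
  refine ⟨K * Real.exp (R + R ^ 2 / 2 + b ^ 2), by positivity, fun w hw x => ?_⟩
  have hR : 0 ≤ R := (norm_nonneg w).trans hw
  rw [polyCoh, norm_mul, norm_cohFun, mul_assoc K, ← Real.exp_add]
  refine (mul_le_mul_of_nonneg_right (h _) (Real.exp_pos _).le).trans ?_
  rw [mul_assoc K, ← Real.exp_add]
  refine mul_le_mul_of_nonneg_left (Real.exp_le_exp.mpr ?_) hK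
  have h1 : ‖sqrtTwo * x - w‖ ≤ Real.sqrt 2 * |x| + R := by
    refine (norm_sub_le _ _).trans (add_le_add ?_ hw)
    rw [norm_mul, Complex.norm_real, Complex.norm_real, Real.norm_eq_abs, Real.norm_eq_abs,
      abs_of_nonneg (Real.sqrt_nonneg 2)]
  have h2 : Real.sqrt 2 * w.re * x ≤ Real.sqrt 2 * R * |x| := by
    rw [mul_assoc, mul_assoc]
    refine mul_le_mul_of_nonneg_left ((le_abs_self _).trans ?_) (Real.sqrt_nonneg 2)
    rw [abs_mul]
    exact mul_le_mul_of_nonneg_right ((Complex.abs_re_le_norm w).trans hw) (abs_nonneg x)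
  have h3 : -(w ^ 2).re ≤ R ^ 2 := by
    refine (neg_le_abs _).trans ((Complex.abs_re_le_norm _).trans ?_)
    rw [norm_pow]
    exact pow_le_pow_left₀ (norm_nonneg w) hw 2
  have h4 : b * |x| ≤ x ^ 2 / 4 + b ^ 2 := by
    rw [← sq_abs x]
    nlinarith [sq_nonneg (|x| / 2 - b)]
  have h5 : b * |x| = Real.sqrt 2 * |x| + Real.sqrt 2 * R * |x| := by ring
  linarith

/-- The effect of `d/dx` on the polynomial factor of `polyCoh`. -/
def diffCoh (w : ℂ) (P : Polynomial ℂ) : Polynomial ℂ :=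
  Polynomial.C sqrtTwo * P.derivative +
    Polynomial.C invSqrtTwo * ((Polynomial.C w - Polynomial.X) * P)

theorem hasDerivAt_polyCoh (P : Polynomial ℂ) (w : ℂ) (x : ℝ) :
    HasDerivAt (polyCoh P w) (polyCoh (diffCoh w P) w x) x := by
  have h0 : HasDerivAt (fun x : ℝ => (x : ℂ)) 1 x := Complex.ofRealCLM.hasDerivAt
  have h1 : HasDerivAt (fun x : ℝ => sqrtTwo * x - w) sqrtTwo x := by
    simpa using (h0.const_mul sqrtTwo).sub_const w
  have h2 := (P.hasDerivAt (sqrtTwo * x - w)).comp x h1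
  have h3 : HasDerivAt (fun x : ℝ => -(x : ℂ) ^ 2 / 2 + sqrtTwo * w * x - w ^ 2 / 2)
      (-x + sqrtTwo * w) x := by
    convert! ((((h0.pow 2).neg.div_const 2).add (h0.const_mul (sqrtTwo * w))).sub_const
      (w ^ 2 / 2)) using 1
    push_cast
    ring
  refine (h2.mul h3.cexp).congr_deriv ?_
  simp only [polyCoh, diffCoh, cohFun, Polynomial.eval_add, Polynomial.eval_mul, Polynomial.eval_C,
    Polynomial.eval_sub, Polynomial.eval_X, invSqrtTwo_eq, Function.comp_apply]
  linear_combination (x * P.eval (sqrtTwo * x - w) *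
    Complex.exp (-(x : ℂ) ^ 2 / 2 + sqrtTwo * w * x - w ^ 2 / 2) / 2) * sqrtTwo_mul_self

/-- The factor `exp (-w ^ 2 / 2)` in `cohFun` makes the `w`-derivative of the exponent equal to `√2
x - w`. The resulting polynomial is the one in `creS_polyCohS`: creation is differentiation in `w`.
-/
theorem hasDerivAt_polyCoh_param (P : Polynomial ℂ) (w : ℂ) (x : ℝ) :
    HasDerivAt (fun w => polyCoh P w x) (polyCoh (Polynomial.X * P - P.derivative) w x) w := by
  have h1 : HasDerivAt (fun w : ℂ => sqrtTwo * x - w) (-1) w := by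
    simpa using (hasDerivAt_id w).const_sub (sqrtTwo * x)
  have h2 := (P.hasDerivAt (sqrtTwo * x - w)).comp w h1
  have h3 : HasDerivAt (fun w : ℂ => -(x : ℂ) ^ 2 / 2 + sqrtTwo * w * x - w ^ 2 / 2)
      (sqrtTwo * x - w) w := by
    convert! ((((hasDerivAt_id w).const_mul sqrtTwo).mul_const (x : ℂ)).const_add
      (-(x : ℂ) ^ 2 / 2)).sub (((hasDerivAt_id w).pow 2).div_const 2) using 1
    simp
  refine (h2.mul h3.cexp).congr_deriv ?_
  simp only [polyCoh, cohFun, Polynomial.eval_mul, Polynomial.eval_sub, Polynomial.eval_X,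
    Function.comp_apply]
  ring

theorem iteratedDeriv_polyCoh (P : Polynomial ℂ) (w : ℂ) (n : ℕ) :
    iteratedDeriv n (polyCoh P w) = polyCoh ((diffCoh w)^[n] P) w := by
  induction n with
  | zero => rfl
  | succ n ih =>
    rw [iteratedDeriv_succ, ih, Function.iterate_succ_apply']
    exact funext fun x => (hasDerivAt_polyCoh _ w x).deriv

theorem contDiff_polyCoh (P : Polynomial ℂ) (w : ℂ) : ContDiff ℝ ∞ (polyCoh P w) := by
  refine contDiff_of_differentiable_iteratedDeriv fun n _ => ?_
  rw [iteratedDeriv_polyCoh]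
  exact fun x => (hasDerivAt_polyCoh _ w x).differentiableAt

theorem pow_mul_polyCoh (P : Polynomial ℂ) (w : ℂ) (k : ℕ) (x : ℝ) :
    (x : ℂ) ^ k * polyCoh P w x =
      polyCoh ((Polynomial.C invSqrtTwo * (Polynomial.X + Polynomial.C w)) ^ k * P) w x := by
  have h : invSqrtTwo * (sqrtTwo * x - w + w) = x := by
    rw [invSqrtTwo_eq]
    linear_combination (x / 2 : ℂ) * sqrtTwo_mul_self
  simp only [polyCoh, Polynomial.eval_mul, Polynomial.eval_pow, Polynomial.eval_C,
    Polynomial.eval_add, Polynomial.eval_X, h, mul_assoc]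

/-- Polynomials times coherent states, as Schwartz functions. -/
def polyCohS (P : Polynomial ℂ) (w : ℂ) : 𝓢(ℝ, ℂ) where
  toFun := polyCoh P w
  smooth' := contDiff_polyCoh P w
  decay' k n := by
    obtain ⟨K, hK, h⟩ := exists_norm_polyCoh_le
      ((Polynomial.C invSqrtTwo * (Polynomial.X + Polynomial.C w)) ^ k * (diffCoh w)^[n] P) ‖w‖
    refine ⟨K, fun x => ?_⟩
    rw [norm_iteratedFDeriv_eq_norm_iteratedDeriv, iteratedDeriv_polyCoh, ← Complex.norm_real,
      ← norm_pow, ← norm_mul, pow_mul_polyCoh]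
    refine (h w le_rfl x).trans (mul_le_of_le_one_right hK (Real.exp_le_one_iff.mpr ?_))
    nlinarith [sq_nonneg x]

theorem polyCohS_apply (P : Polynomial ℂ) (w : ℂ) (x : ℝ) : polyCohS P w x = polyCoh P w x := rfl

theorem deriv_polyCohS (P : Polynomial ℂ) (w : ℂ) (x : ℝ) :
    deriv (polyCohS P w) x = polyCoh (diffCoh w P) w x := (hasDerivAt_polyCoh P w x).deriv

theorem creS_polyCohS (P : Polynomial ℂ) (w : ℂ) :
    creS (polyCohS P w) = polyCohS (Polynomial.X * P - P.derivative) w := by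
  ext x
  change invSqrtTwo * (mulX (polyCohS P w) x - derivS (polyCohS P w) x) = _
  rw [mulX_apply, derivS_apply, deriv_polyCohS]
  simp only [polyCohS_apply, polyCoh, diffCoh, Polynomial.eval_add, Polynomial.eval_mul,
    Polynomial.eval_C, Polynomial.eval_sub, Polynomial.eval_X, invSqrtTwo_eq]
  linear_combination (-(P.derivative.eval (sqrtTwo * x - w)) / 2 -
    P.eval (sqrtTwo * x - w) * (2 * w - sqrtTwo * x) / 4) * cohFun w x * sqrtTwo_mul_self

/-- The coherent state of parameter `w`. -/
def cohS (w : ℂ) : 𝓢(ℝ, ℂ) := polyCohS 1 w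

theorem annS_cohS (w : ℂ) : annS (cohS w) = w • cohS w := by
  ext x
  change invSqrtTwo * (mulX (cohS w) x + derivS (cohS w) x) = w * cohS w x
  rw [mulX_apply, derivS_apply, cohS, deriv_polyCohS]
  simp only [polyCohS_apply, polyCoh, diffCoh, Polynomial.eval_add, Polynomial.eval_mul,
    Polynomial.eval_C, Polynomial.eval_sub, Polynomial.eval_X, invSqrtTwo_eq, Polynomial.eval_one,
    Polynomial.derivative_one, Polynomial.eval_zero]
  linear_combination (2 * w - sqrtTwo * x) / 4 * cohFun w x * sqrtTwo_mul_self

/-- The polynomial factors of the states `(a†)ⁿ |w⟩`. -/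
def ladderPoly (n : ℕ) : Polynomial ℂ := (fun P => Polynomial.X * P - P.derivative)^[n] 1

theorem creS_pow_cohS (n : ℕ) (w : ℂ) : (creS ^ n) (cohS w) = polyCohS (ladderPoly n) w := by
  induction n with
  | zero => rfl
  | succ n ih =>
    rw [pow_succ', Module.End.mul_apply, ih, creS_polyCohS, ladderPoly, ladderPoly,
      Function.iterate_succ_apply']

/-! ### Transforms of square-integrable functions -/

theorem inner_toL2_right (f : L2) (φ : 𝓢(ℝ, ℂ)) :
    inner ℂ f (toL2 φ) = ∫ x, φ x * conj (f x) := by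
  rw [L2.inner_def]
  refine integral_congr_ae ?_
  filter_upwards [coeFn_toL2 φ] with x hx
  rw [hx, RCLike.inner_apply]

theorem integrable_exp_mul_L2 (f : L2) (K : ℝ) :
    Integrable fun x : ℝ => K * Real.exp (-x ^ 2 / 4) * ‖f x‖ := by
  have h1 : MemLp (fun x : ℝ => K * Real.exp (-x ^ 2 / 4)) 2 (volume : Measure ℝ) := by
    refine MemLp.const_mul ?_ K
    rw [memLp_two_iff_integrable_sq (by fun_prop)]
    refine (integrable_exp_neg_mul_sq (b := 1 / 2) (by norm_num)).congr
      (Filter.Eventually.of_forall fun x => ?_)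
    simp only
    rw [← Real.exp_nat_mul]
    congr 1
    push_cast
    ring
  exact h1.integrable_mul (Lp.memLp f).norm

theorem hasDerivAt_inner_polyCohS (f : L2) (P : Polynomial ℂ) (w : ℂ) :
    HasDerivAt (fun w => inner ℂ f (toL2 (polyCohS P w)))
      (inner ℂ f (toL2 (creS (polyCohS P w)))) w := by
  simp only [creS_polyCohS, inner_toL2_right, polyCohS_apply]
  obtain ⟨K, hK, hb⟩ := exists_norm_polyCoh_le P (‖w‖ + 1)
  obtain ⟨K', hK', hb'⟩ :=
    exists_norm_polyCoh_le (Polynomial.X * P - P.derivative) (‖w‖ + 1)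
  have hmeas (Q : Polynomial ℂ) (w : ℂ) :
      AEStronglyMeasurable (fun x => polyCoh Q w x * conj (f x)) volume :=
    (contDiff_polyCoh Q w).continuous.aestronglyMeasurable.mul
      (Complex.continuous_conj.comp_aestronglyMeasurable (Lp.aestronglyMeasurable f))
  refine (hasDerivAt_integral_of_dominated_loc_of_deriv_le
    (F' := fun w x => polyCoh (Polynomial.X * P - P.derivative) w x * conj (f x)) (Metric.ball_mem_nhds w one_pos)
    (Filter.Eventually.of_forall fun z => hmeas P z) ?_ (hmeas _ w) ?_
    (integrable_exp_mul_L2 f K') ?_).2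
  · refine (integrable_exp_mul_L2 f K).mono' (hmeas P w)
      (Filter.Eventually.of_forall fun x => ?_)
    rw [norm_mul, RCLike.norm_conj]
    exact mul_le_mul_of_nonneg_right (hb w (by linarith) x) (norm_nonneg _)
  · refine Filter.Eventually.of_forall fun x z hz => ?_
    rw [norm_mul, RCLike.norm_conj]
    refine mul_le_mul_of_nonneg_right (hb' z ?_ x) (norm_nonneg _)
    have := norm_le_norm_add_norm_sub' z w
    rw [Metric.mem_ball, dist_eq_norm] at hz
    linarith
  · exact Filter.Eventually.of_forall fun x z _ => (hasDerivAt_polyCoh_param P z x).mul_const _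

theorem hasDerivAt_inner_creS_pow_cohS (f : L2) (n : ℕ) (w : ℂ) :
    HasDerivAt (fun w => inner ℂ f (toL2 ((creS ^ n) (cohS w))))
      (inner ℂ f (toL2 ((creS ^ (n + 1)) (cohS w)))) w := by
  rw [pow_succ', Module.End.mul_apply]
  simp only [creS_pow_cohS]
  exact hasDerivAt_inner_polyCohS f _ w

/-- The coherent states are complete. -/
theorem eq_zero_of_inner_cohS_eq_zero (f : L2) (h : ∀ w, inner ℂ f (toL2 (cohS w)) = 0) :
    f = 0 := by
  set g : ℝ → ℂ := fun x => Complex.exp (-(x : ℂ) ^ 2 / 2) * conj (f x) with hg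
  have hgi : Integrable g := by
    refine (integrable_exp_mul_L2 f 1).mono' ?_ (Filter.Eventually.of_forall fun x => ?_)
    · exact (Continuous.aestronglyMeasurable (by fun_prop)).mul
        (Complex.continuous_conj.comp_aestronglyMeasurable (Lp.aestronglyMeasurable f))
    · rw [hg]
      simp only
      rw [norm_mul, RCLike.norm_conj, one_mul]
      refine mul_le_mul_of_nonneg_right ?_ (norm_nonneg _)
      rw [show (-(x : ℂ) ^ 2 / 2) = ((-x ^ 2 / 2 : ℝ) : ℂ) by push_cast; ring, ← Complex.ofReal_exp,
        Complex.norm_real, Real.norm_of_nonneg (Real.exp_pos _).le, Real.exp_le_exp]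
      nlinarith [sq_nonneg x]
  have hfou (ξ : ℝ) : FourierTransform.fourier g ξ = 0 := by
    -- This parameter turns `√2 w x` into the Fourier phase `-2πi x ξ`.
    have h1 := h (-(sqrtTwo * Real.pi * ξ * Complex.I))
    rw [inner_toL2_right] at h1
    rw [Real.fourier_real_eq_integral_exp_smul]
    have h2 : ∀ x : ℝ, Complex.exp (↑(-2 * Real.pi * x * ξ) * Complex.I) • g x =
        Complex.exp ((-(sqrtTwo * Real.pi * ξ * Complex.I)) ^ 2 / 2) *
          (cohS (-(sqrtTwo * Real.pi * ξ * Complex.I)) x * conj (f x)) := by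
      intro x
      change _ = _ * (polyCoh 1 _ x * _)
      rw [polyCoh, Polynomial.eval_one, one_mul, cohFun, hg, smul_eq_mul, ← mul_assoc, ← mul_assoc,
        ← Complex.exp_add, ← Complex.exp_add]
      congr 2
      push_cast
      linear_combination (Real.pi * ξ * Complex.I * x : ℂ) * sqrtTwo_mul_self
    simp only [h2]
    rw [integral_const_mul, h1, mul_zero]
  have hg0 : ∀ᵐ x : ℝ, g x = 0 := by
    -- Each test function is the Fourier transform of a Schwartz function, and the transform can be
    -- moved onto `g`, where it vanishes.
    refine ae_eq_zero_of_integral_contDiff_smul_eq_zero hgi.locallyIntegrable fun φ hφ hc => ?_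
    have hc1 : HasCompactSupport (Complex.ofRealCLM ∘ φ) := hc.comp_left rfl
    have hc2 : ContDiff ℝ ∞ (Complex.ofRealCLM ∘ φ) := by fun_prop
    set ψ : 𝓢(ℝ, ℂ) := hc1.toSchwartzMap hc2 with hψ
    set χ : 𝓢(ℝ, ℂ) := FourierTransformInv.fourierInv ψ with hχ
    have h1 : FourierTransform.fourier χ = ψ := by simp [hχ]
    have h2 := VectorFourier.integral_fourierIntegral_smul_eq_flip (L := innerₗ ℝ)
      Real.continuous_fourierChar continuous_inner (χ.integrable (μ := volume)) hgi
    have h3 : ∫ x, FourierTransform.fourier χ x • g x =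
        ∫ x, χ x • FourierTransform.fourier g x := by
      simpa using! h2
    simpa [h1, hfou, hψ] using h3
  refine Lp.ext ?_
  filter_upwards [hg0, Lp.coeFn_zero ℂ 2 (volume : Measure ℝ)] with x h1 h2
  rw [h2, Pi.zero_apply]
  simpa [hg] using h1

/-! ### Towers of derivatives of entire functions -/

section Entire

variable {F : ℕ → ℂ → ℂ}

theorem iteratedDeriv_tower (hF : ∀ n w, HasDerivAt (F n) (F (n + 1) w) w) (n m : ℕ) :
    iteratedDeriv m (F n) = F (n + m) := by
  induction m with
  | zero => exact iteratedDeriv_zero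
  | succ m ih =>
    rw [iteratedDeriv_succ, ih]
    exact funext fun w => (hF (n + m) w).deriv

theorem hasSum_tower (hF : ∀ n w, HasDerivAt (F n) (F (n + 1) w) w) (n : ℕ) (c z : ℂ) :
    HasSum (fun m : ℕ => (m.factorial : ℂ)⁻¹ • (z - c) ^ m • F (n + m) c) (F n z) := by
  have h := Complex.hasSum_taylorSeries_of_entire
    (fun w => (hF n w).differentiableAt : Differentiable ℂ (F n)) c z
  simpa only [iteratedDeriv_tower hF] using h

theorem tower_eq_zero_of_forall (hF : ∀ n w, HasDerivAt (F n) (F (n + 1) w) w) {n : ℕ} {c : ℂ}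
    (h : ∀ m, F (n + m) c = 0) (z : ℂ) : F n z = 0 :=
  (hasSum_tower hF n c z).unique (by simp [h, hasSum_zero])

theorem tower_eq_zero_of_roots (hF : ∀ n w, HasDerivAt (F n) (F (n + 1) w) w) {n k : ℕ}
    (hk : ∀ w, F (n + k) w = 0) (s : Finset ℂ) (hs : s.card = k) (h : ∀ β ∈ s, F n β = 0) (z : ℂ) :
    F n z = 0 := by
  have hz (m : ℕ) : ∀ w, F (n + k + m) w = 0 := by
    induction m with
    | zero => exact hk
    | succ m ih =>
      intro w
      have h1 : F (n + k + m) = fun _ => 0 := funext ih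
      have h2 := hF (n + k + m) w
      rw [h1] at h2
      exact h2.unique (hasDerivAt_const w 0)
  -- The Taylor polynomial at `0`; all later coefficients vanish.
  set P : Polynomial ℂ :=
    ∑ m ∈ Finset.range k, Polynomial.monomial m ((m.factorial : ℂ)⁻¹ * F (n + m) 0) with hP
  have hFP (z : ℂ) : F n z = P.eval z := by
    refine (hasSum_tower hF n 0 z).unique ?_
    have : P.eval z =
        ∑ m ∈ Finset.range k, (m.factorial : ℂ)⁻¹ • (z - 0) ^ m • F (n + m) 0 := by
      rw [hP, Polynomial.eval_finsetSum]
      refine Finset.sum_congr rfl fun m _ => ?_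
      rw [Polynomial.eval_monomial, sub_zero, smul_eq_mul, smul_eq_mul]
      ring
    rw [this]
    refine hasSum_sum_of_ne_finset_zero fun m hm => ?_
    obtain ⟨i, rfl⟩ := Nat.exists_eq_add_of_le (not_lt.mp (mt Finset.mem_range.mpr hm))
    rw [← add_assoc, hz, smul_zero, smul_zero]
  have hdeg : P.degree < s.card := by
    rw [hs, Polynomial.degree_lt_iff_coeff_zero]
    intro m hm
    rw [hP, Polynomial.finsetSum_coeff]
    refine Finset.sum_eq_zero fun i hi => Polynomial.coeff_monomial_of_ne _ ?_
    have := Finset.mem_range.mp hi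
    omega
  have hP0 := Polynomial.eq_zero_of_degree_lt_of_eval_finset_eq_zero s hdeg
    fun β hβ => by rw [← hFP, h β hβ]
  rw [hFP, hP0, Polynomial.eval_zero]

theorem tower_eq_zero (hF : ∀ n w, HasDerivAt (F n) (F (n + 1) w) w) {k N : ℕ} (hk : 0 < k)
    (s : Finset ℂ) (hs : s.card = k) (h : ∀ β ∈ s, ∀ j, F (k * j) β = 0) {c : ℂ}
    (hN : ∀ n, N ≤ n → F n c = 0) (z : ℂ) : F 0 z = 0 := by
  suffices H : ∀ i ≤ N, ∀ z, F (k * (N - i)) z = 0 by simpa using H N le_rfl z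
  intro i
  induction i with
  | zero =>
    intro _ z
    refine tower_eq_zero_of_forall hF (c := c) (fun m => hN _ ?_) z
    -- As `k * N ≥ N`, every Taylor coefficient of `F (k * N)` at `c` vanishes.
    have := Nat.le_mul_of_pos_left N hk
    rw [Nat.sub_zero]
    omega
  | succ i ih =>
    intro hi z
    refine tower_eq_zero_of_roots hF (k := k) ?_ s hs (fun β hβ => h β hβ _) z
    rw [← Nat.mul_succ, Nat.succ_eq_add_one, show N - (i + 1) + 1 = N - i by omega]
    exact ih (by omega)

end Entire

/-! ### The kernel of `L` -/

theorem inner_toL2_creS_of_eigenvector {u : L2} {β : ℂ} (hu : (u, β • u) ∈ annihilation.graph)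
    (φ : 𝓢(ℝ, ℂ)) : inner ℂ u (toL2 (creS φ)) = conj β * inner ℂ u (toL2 φ) := by
  rw [LinearPMap.mem_graph_iff] at hu
  obtain ⟨y, rfl, hy⟩ := hu
  rw [← inner_conj_symm, ← inner_toL2_annihilation, hy, inner_smul_right, map_mul, inner_conj_symm]

theorem cohS_mem_annihilation_graph (w : ℂ) :
    (toL2 (cohS w), w • toL2 (cohS w)) ∈ annihilation.graph := by
  obtain ⟨h, h'⟩ := extends_annihilation (cohS w)
  rw [annS_cohS, map_smul] at h'
  rw [← h']
  exact annihilation.mem_graph ⟨_, h⟩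

/-- Removing the projection onto the coherent state leaves an eigenvector orthogonal to it, hence,
by moving `creS` across the inner product, to all `creS ^ m (cohS β)`. These pairings are the Taylor
coefficients at `β` of its coherent-state transform, which is therefore zero. -/
theorem exists_eq_smul_cohS {u : L2} {β : ℂ} (hu : (u, β • u) ∈ annihilation.graph) :
    ∃ c : ℂ, u = c • toL2 (cohS β) := by
  set e := toL2 (cohS β) with he
  set c : ℂ := inner ℂ e u / inner ℂ e e with hc
  have hg : (u - c • e, β • (u - c • e)) ∈ annihilation.graph := by
    have := annihilation.graph.sub_mem hu
      (annihilation.graph.smul_mem c (cohS_mem_annihilation_graph β))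
    rwa [Prod.smul_mk, Prod.mk_sub_mk, smul_comm c β, ← smul_sub] at this
  have h0 : inner ℂ (u - c • e) e = 0 := by
    rw [inner_eq_zero_symm, inner_sub_right, inner_smul_right]
    by_cases h : e = 0
    · simp [h]
    · rw [hc, div_mul_cancel₀ _ (inner_self_ne_zero.mpr h), sub_self]
  have hz (m : ℕ) : inner ℂ (u - c • e) (toL2 ((creS ^ m) (cohS β))) = 0 := by
    induction m with
    | zero => exact h0
    | succ m ih =>
      rw [pow_succ', Module.End.mul_apply, inner_toL2_creS_of_eigenvector hg, ih, mul_zero]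
  refine ⟨c, sub_eq_zero.mp (eq_zero_of_inner_cohS_eq_zero _ fun w => ?_)⟩
  exact tower_eq_zero_of_forall (n := 0) (c := β)
    (F := fun n w => inner ℂ (u - c • e) (toL2 ((creS ^ n) (cohS w))))
    (hasDerivAt_inner_creS_pow_cohS _) (fun m => by simpa using hz m) w

theorem exists_orbit {E : Type*} [AddCommGroup E] [Module ℂ E] (A : E →ₗ.[ℂ] E) (n : ℕ)
    (v : (ppow A n).domain) : ∃ u : ℕ → E, u 0 = v ∧ u n = ppow A n v ∧
      ∀ m < n, (u m, u (m + 1)) ∈ A.graph := by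
  classical
  have hanti (m : ℕ) : (ppow A (m + 1)).domain ≤ (ppow A m).domain :=
    fun x hx => (mem_pcomp_domain.mp hx).1
  have hmem (m : ℕ) (hm : m ≤ n) : (v : E) ∈ (ppow A m).domain :=
    antitone_nat_of_succ_le (f := fun m => (ppow A m).domain) hanti hm v.2
  -- The default `0` can occur only for `m > n`.
  refine ⟨fun m => if h : (v : E) ∈ (ppow A m).domain then ppow A m ⟨v, h⟩ else 0, ?_, ?_, ?_⟩
  · exact dif_pos (hmem 0 n.zero_le)
  · exact dif_pos v.2
  · intro m hm
    dsimp only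
    rw [dif_pos (hmem m hm.le), dif_pos (hmem (m + 1) hm)]
    exact A.mem_graph ⟨_, (mem_pcomp_domain.mp (hmem (m + 1) hm)).2⟩

/-- The `k`-th roots of `αᵏ`. -/
def catRoot (α : ℝ) (k i : ℕ) : ℂ := α * Complex.exp (2 * Real.pi * Complex.I / k) ^ i

section CatRoot

variable {α : ℝ} {k : ℕ}

theorem catRoot_pow (hk : k ≠ 0) (i : ℕ) : catRoot α k i ^ k = (α : ℂ) ^ k := by
  rw [catRoot, mul_pow, ← pow_mul, mul_comm i, pow_mul,
    (Complex.isPrimitiveRoot_exp k hk).pow_eq_one, one_pow, mul_one]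

theorem catRoot_ne_zero (hα : α ≠ 0) (i : ℕ) : catRoot α k i ≠ 0 :=
  mul_ne_zero (Complex.ofReal_ne_zero.mpr hα) (pow_ne_zero _ (Complex.exp_ne_zero _))

theorem card_catRoots (hα : α ≠ 0) (hk : k ≠ 0) :
    ((Finset.range k).image (catRoot α k)).card = k := by
  rw [Finset.card_image_of_injOn, Finset.card_range]
  intro i hi j hj hij
  refine (Complex.isPrimitiveRoot_exp k hk).pow_inj (by simpa using hi) (by simpa using hj) ?_
  exact mul_left_cancel₀ (Complex.ofReal_ne_zero.mpr hα) hij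

theorem sum_inv_catRoot_pow (hk : k ≠ 0) {m : ℕ} (hm0 : m ≠ 0) (hm : m < k) :
    ∑ i ∈ Finset.range k, (catRoot α k i)⁻¹ ^ m = 0 := by
  have hprim := Complex.isPrimitiveRoot_exp k hk
  set ζ := Complex.exp (2 * Real.pi * Complex.I / k)
  have h1 : ζ⁻¹ ^ m ≠ 1 := by
    rw [inv_pow, Ne, inv_eq_one]
    exact hprim.pow_ne_one_of_pos_of_lt hm0 hm
  have h2 : ∑ i ∈ Finset.range k, (ζ⁻¹ ^ m) ^ i = 0 := by
    rw [geom_sum_eq h1, ← pow_mul, mul_comm m, pow_mul, inv_pow ζ k, hprim.pow_eq_one, inv_one,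
      one_pow, sub_self, zero_div]
  calc ∑ i ∈ Finset.range k, (catRoot α k i)⁻¹ ^ m
      = ∑ i ∈ Finset.range k, (α : ℂ)⁻¹ ^ m * (ζ⁻¹ ^ m) ^ i := by
        refine Finset.sum_congr rfl fun i _ => ?_
        rw [catRoot, mul_inv, mul_pow, ← inv_pow, ← pow_mul, ← pow_mul, mul_comm i]
    _ = 0 := by rw [← Finset.mul_sum, h2, mul_zero]

/-- The kernel of `L` consists of (classes of) Schwartz functions. -/
theorem exists_toL2_eq_of_mem_kernel (hα : α ≠ 0) (hk : k ≠ 0) {v : L2}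
    (hv : v ∈ kernel (opL α k)) : ∃ φ : 𝓢(ℝ, ℂ), toL2 φ = v := by
  obtain ⟨h, h'⟩ := mem_kernel.mp hv
  have hvk : ppow annihilation k ⟨v, h.1⟩ = ((α : ℂ) ^ k) • v := sub_eq_zero.mp h'
  obtain ⟨u, hu0, huk, hu⟩ := exists_orbit annihilation k ⟨v, h.1⟩
  rw [hvk] at huk
  -- Up to a scalar, `p i` is `(a ^ k - β ^ k) / (a - β)` applied to `v`, with `β = catRoot α k i`,
  -- hence an eigenvector.
  set p : ℕ → L2 := fun i => ∑ m ∈ Finset.range k, (catRoot α k i)⁻¹ ^ m • u m with hp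
  have hpg (i : ℕ) : (p i, catRoot α k i • p i) ∈ annihilation.graph := by
    set β := catRoot α k i with hβ
    have hβ0 : β ≠ 0 := catRoot_ne_zero hα i
    have h1 := annihilation.graph.sum_mem (t := Finset.range k)
      (fun m hm => annihilation.graph.smul_mem (β⁻¹ ^ m) (hu m (Finset.mem_range.mp hm)))
    convert h1 using 1
    refine Prod.ext ?_ ?_
    · simp only [hp, Prod.fst_sum, Prod.smul_fst]; rfl
    -- The sum is cyclic: its term at `m = k` equals its term at `m = 0`, because `a ^ k v = β ^ k
    -- v`.
    · have h2 : p i = ∑ m ∈ Finset.range k, β⁻¹ ^ (m + 1) • u (m + 1) := by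
        have h3 := Finset.sum_range_succ (fun m => β⁻¹ ^ m • u m) k
        rw [Finset.sum_range_succ', huk, smul_smul, inv_pow β k, hβ, catRoot_pow hk,
          inv_mul_cancel₀ (pow_ne_zero _ (Complex.ofReal_ne_zero.mpr hα)), pow_zero, one_smul,
          one_smul, hu0] at h3
        exact (add_right_cancel h3).symm
      rw [Prod.snd_sum, h2]
      refine Finset.smul_sum.trans ?_
      refine Finset.sum_congr rfl fun m _ => ?_
      rw [smul_smul, pow_succ', ← mul_assoc, mul_inv_cancel₀ hβ0, one_mul, Prod.smul_snd]
  have hsum : ∑ i ∈ Finset.range k, p i = (k : ℂ) • v := by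
    rw [hp, Finset.sum_comm, Finset.sum_eq_single 0]
    · simp [hu0, ← Nat.cast_smul_eq_nsmul ℂ]
    · intro m hm hm0
      rw [← Finset.sum_smul, sum_inv_catRoot_pow hk hm0 (Finset.mem_range.mp hm), zero_smul]
    · intro h0
      exact absurd (Finset.mem_range.mpr (Nat.pos_of_ne_zero hk)) h0
  have hv' : v ∈ LinearMap.range toL2 := by
    have h1 : ∑ i ∈ Finset.range k, p i ∈ LinearMap.range toL2 := by
      refine Submodule.sum_mem _ fun i _ => ?_
      obtain ⟨c, hc⟩ := exists_eq_smul_cohS (hpg i)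
      exact ⟨c • cohS (catRoot α k i), by rw [map_smul, hc]⟩
    rw [hsum] at h1
    exact (Submodule.smul_mem_iff _ (Nat.cast_ne_zero.mpr hk)).mp h1
  exact hv'

theorem annS_pow_cohS (w : ℂ) (n : ℕ) : (annS ^ n) (cohS w) = w ^ n • cohS w := by
  induction n with
  | zero => simp
  | succ n ih =>
    rw [pow_succ, Module.End.mul_apply, annS_cohS, map_smul, ih, smul_smul, pow_succ']

theorem cohS_mem_kernel (hk : k ≠ 0) (i : ℕ) :
    toL2 (cohS (catRoot α k i)) ∈ kernel (opL α k) := by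
  obtain ⟨h, h'⟩ := extends_opL α k (cohS (catRoot α k i))
  refine mem_kernel.mpr ⟨h, h'.trans ?_⟩
  rw [LinearMap.sub_apply, annS_pow_cohS, catRoot_pow hk, LinearMap.smul_apply,
    Module.End.one_apply, sub_self, map_zero]

end CatRoot

/-! ### Vectors orthogonal to both spans -/

theorem extends_pow_mul_iterComm (α : ℝ) (k j s : ℕ) :
    Extends toL2 (pcomp (ppow ((opL α k)†) j) (iterComm (opL α k) ((opL α k)†) s))
      ((creS ^ k - ((α : ℂ) ^ k) • 1) ^ j * weylComm annS creS ((α : ℂ) ^ k) k s) :=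
  ((extends_adjoint_opL α k).ppow j).pcomp ((extends_opL α k).iterComm (extends_adjoint_opL α k) s)

theorem eq_zero_of_orthogonal {α : ℝ} (hα : α ≠ 0) {k : ℕ} (hk : k ≠ 0) {f : L2}
    (h : ∀ g ∈ spanA (opL α k) ⊔ spanSharp (opL α k) k, inner ℂ f g = 0) : f = 0 := by
  let ℓ : 𝓢(ℝ, ℂ) →ₗ[ℂ] ℂ := (innerₛₗ ℂ f) ∘ₗ toL2
  have h0 (i j : ℕ) :
      ℓ (((creS ^ k - ((α : ℂ) ^ k) • 1) ^ j) (cohS (catRoot α k i))) = 0 := by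
    obtain ⟨h1, h2⟩ := (extends_adjoint_opL α k).ppow j (cohS (catRoot α k i))
    refine h _ (Submodule.mem_sup_left (Submodule.subset_span ?_))
    exact ⟨j, ⟨_, h1⟩, cohS_mem_kernel hk i, h2.symm⟩
  have h1 (i j s : ℕ) (hs : 1 ≤ s) (hs' : s ≤ k - 1) :
      ℓ (((creS ^ k - ((α : ℂ) ^ k) • 1) ^ j)
        (weylComm annS creS ((α : ℂ) ^ k) k s (cohS (catRoot α k i)))) = 0 := by
    obtain ⟨h1, h2⟩ := extends_pow_mul_iterComm α k j s (cohS (catRoot α k i))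
    refine h _ (Submodule.mem_sup_right (Submodule.subset_span ?_))
    exact ⟨j, s, hs, hs', ⟨_, h1⟩, cohS_mem_kernel hk i, h2.symm⟩
  refine eq_zero_of_inner_cohS_eq_zero f fun z => ?_
  refine tower_eq_zero (F := fun n w => inner ℂ f (toL2 ((creS ^ n) (cohS w))))
    (hasDerivAt_inner_creS_pow_cohS f) (Nat.pos_of_ne_zero hk) _ (card_catRoots hα hk)
    (c := catRoot α k 0) (N := k * k) ?_ ?_ z
  · intro β hβ j
    obtain ⟨i, -, rfl⟩ := Finset.mem_image.mp hβ
    rw [pow_mul]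
    exact functional_pow_eq_zero ℓ _ _ (h0 i) j
  · intro n hn
    -- The commutator span is needed at a single root only; the other roots enter through powers of
    -- the adjoint.
    exact functional_creation_pow_eq_zero annS_mul_creS (catRoot_ne_zero hα 0) (annS_cohS _) ℓ _
      (Nat.pos_of_ne_zero hk) (h0 0) (h1 0) hn

end

end CatQubit

theorem mainTheorem4 (α : ℝ) (hα : α ≠ 0) (k : ℕ) (hk : 3 ≤ k) :
    (∀ v ∈ CatQubit.kernel (CatQubit.opL α k), ∀ j : ℕ,
      v ∈ (CatQubit.ppow ((CatQubit.opL α k)†) j).domain ∧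
      ∀ s : ℕ, 1 ≤ s → s ≤ k - 1 →
        v ∈ (CatQubit.pcomp (CatQubit.ppow ((CatQubit.opL α k)†) j)
          (CatQubit.iterComm (CatQubit.opL α k) ((CatQubit.opL α k)†) s)).domain) ∧
    Dense ((CatQubit.spanA (CatQubit.opL α k) ⊔
      CatQubit.spanSharp (CatQubit.opL α k) k : Submodule ℂ CatQubit.L2) :
        Set CatQubit.L2) := by
  refine ⟨fun v hv j => ?_, ?_⟩
  · obtain ⟨φ, rfl⟩ := CatQubit.exists_toL2_eq_of_mem_kernel hα (by omega) hv
    exact ⟨((CatQubit.extends_adjoint_opL α k).ppow j φ).1,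
      fun s _ _ => (CatQubit.extends_pow_mul_iterComm α k j s φ).1⟩
  · rw [Submodule.dense_iff_topologicalClosure_eq_top, Submodule.topologicalClosure_eq_top_iff,
      Submodule.eq_bot_iff]
    intro f hf
    exact CatQubit.eq_zero_of_orthogonal hα (by omega)
      fun g hg => Submodule.inner_left_of_mem_orthogonal hg hf
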